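/- Let \[ B=\frac1{\sqrt3}\begin{pmatrix}1&1\\0&1\end{pmatrix},\qquad C=\frac1{\sqrt3}\begin{pmatrix}1&0\\-1&1\end{pmatrix}, \] so that $B^*B+C^*C=I$. Let $\rho_0$ be any density matrix on $\mathbb C^2$ (a positive semidefinite $2\times2$ complex matrix with trace $1$). The open quantum random walk on $\mathbb Z$ generated by $B$ and $C$ with initial state $\rho_0\otimes|0\rangle\langle 0|$ is given by the matrices $\rho^{(n)}_x$ ($n\ge 0$, $x\in\mathbb Z$) with $\rho^{(0)}_0=\rho_0$, $\rho^{(0)}_x=0$ for $x\neq0$, and \[ \rho^{(n+1)}_x=B\rho^{(n)}_{x+1}B^*+C\rho^{(n)}_{x-1}C^*,\qquad x\in\mathbb Z,\ n\ge 0. \] For each $n$, let $X_n$ be the position of the walker at time $n$, that is, a $\mathbb Z$-valued random variable with distribution $P(X_n=x)=\mathrm{Tr}(\rho^{(n)}_x)$, $x\in\mathbb Z$. **Theorem.** As $n\to\infty$, $X_n/\sqrt n$ converges in law to the Gaussian distribution $N(0,8/9)$ with mean $0$ and variance $8/9$. -/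

import Mathlib

open MeasureTheory ProbabilityTheory Filter Topology
open scoped Matrix ComplexOrder

noncomputable section

namespace OQRW

/-- The internal observables: `2 × 2` complex matrices. -/
abbrev M2 : Type := Matrix (Fin 2) (Fin 2) ℂ

/-- `ρ` is a density matrix on `ℂ²`: positive semidefinite with trace one. -/
def IsDensity (ρ : M2) : Prop := ρ.PosSemidef ∧ ρ.trace = 1

/-- One step of the open quantum random walk on `ℤ` generated by `B` (step to the left) and `C`
(step to the right), acting on block diagonal states `∑ₓ ρ x ⊗ |x⟩⟨x|`. -/
def step (B C : M2) (ρ : ℤ → M2) : ℤ → M2 :=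
  fun x => B * ρ (x + 1) * Bᴴ + C * ρ (x - 1) * Cᴴ

/-- The blocks of the state at time `n`, for the initial state `ρ₀ ⊗ |0⟩⟨0|`. -/
def state (B C ρ₀ : M2) (n : ℕ) : ℤ → M2 :=
  (step B C)^[n] (Pi.single 0 ρ₀)

/-- The probability to find the walker at the site `x` at time `n`, the trace of the block at `x`
(a nonnegative real number, see `trace_state`). -/
def prob (B C ρ₀ : M2) (n : ℕ) (x : ℤ) : ℝ :=
  (state B C ρ₀ n x).trace.re

/-- The distribution on `ℤ` of the position of the walker at time `n`. -/
def law (B C ρ₀ : M2) (n : ℕ) : Measure ℤ :=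
  Measure.sum fun x : ℤ => ENNReal.ofReal (prob B C ρ₀ n x) • Measure.dirac x

/-- The operator `B` of the example. -/
def exB : M2 := ((1 / Real.sqrt 3 : ℝ) : ℂ) • !![1, 1; 0, 1]

/-- The operator `C` of the example. -/
def exC : M2 := ((1 / Real.sqrt 3 : ℝ) : ℂ) • !![1, 0; -1, 1]

/-! The helper facts below show that `law` is a probability measure with the point masses `prob`
whenever `Bᴴ * B + Cᴴ * C = 1` and `ρ₀` is a density matrix, and that the example qualifies. -/

theorem state_succ (B C ρ₀ : M2) (n : ℕ) :
    state B C ρ₀ (n + 1) = step B C (state B C ρ₀ n) :=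
  Function.iterate_succ_apply' _ _ _

theorem posSemidef_state (B C : M2) {ρ₀ : M2} (h : ρ₀.PosSemidef) (n : ℕ) (x : ℤ) :
    (state B C ρ₀ n x).PosSemidef := by
  induction n generalizing x with
  | zero =>
    by_cases hx : x = 0
    · subst hx
      simpa [state] using h
    · simpa [state, hx] using Matrix.PosSemidef.zero
  | succ n ih =>
    rw [state_succ]
    exact ((ih _).mul_mul_conjTranspose_same B).add ((ih _).mul_mul_conjTranspose_same C)

theorem prob_nonneg (B C : M2) {ρ₀ : M2} (h : ρ₀.PosSemidef) (n : ℕ) (x : ℤ) :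
    0 ≤ prob B C ρ₀ n x :=
  (Complex.nonneg_iff.1 (posSemidef_state B C h n x).trace_nonneg).1

theorem trace_state (B C : M2) {ρ₀ : M2} (h : ρ₀.PosSemidef) (n : ℕ) (x : ℤ) :
    (state B C ρ₀ n x).trace = (prob B C ρ₀ n x : ℂ) := by
  apply Complex.ext
  · simp [prob]
  · simpa using (Complex.nonneg_iff.1 (posSemidef_state B C h n x).trace_nonneg).2.symm

theorem hasSum_state {B C : M2} (hBC : Bᴴ * B + Cᴴ * C = 1) (ρ₀ : M2) (n : ℕ) :
    ∃ S : M2, HasSum (state B C ρ₀ n) S ∧ S.trace = ρ₀.trace := by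
  induction n with
  | zero => exact ⟨ρ₀, by simpa [state] using hasSum_pi_single (0 : ℤ) ρ₀, rfl⟩
  | succ n ih =>
    obtain ⟨S, hS, ht⟩ := ih
    refine ⟨B * S * Bᴴ + C * S * Cᴴ, ?_, ?_⟩
    · rw [state_succ]
      have h1 : HasSum (fun x : ℤ => state B C ρ₀ n (x + 1)) S :=
        (Equiv.hasSum_iff (Equiv.addRight (1 : ℤ))).2 hS
      have h2 : HasSum (fun x : ℤ => state B C ρ₀ n (x - 1)) S :=
        (Equiv.hasSum_iff (Equiv.subRight (1 : ℤ))).2 hS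
      exact ((h1.mul_left B).mul_right Bᴴ).add ((h2.mul_left C).mul_right Cᴴ)
    · rw [Matrix.trace_add, Matrix.trace_mul_comm, Matrix.trace_mul_comm (C * S), ← Matrix.mul_assoc,
        ← Matrix.mul_assoc, ← Matrix.trace_add, ← Matrix.add_mul, hBC, Matrix.one_mul, ht]

theorem hasSum_prob {B C : M2} (hBC : Bᴴ * B + Cᴴ * C = 1) {ρ₀ : M2} (h : IsDensity ρ₀) (n : ℕ) :
    HasSum (prob B C ρ₀ n) 1 := by
  obtain ⟨S, hS, ht⟩ := hasSum_state hBC ρ₀ n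
  have h1 : HasSum (fun x => (state B C ρ₀ n x).trace.re) S.trace.re :=
    hS.map (Complex.reAddGroupHom.comp (Matrix.traceAddMonoidHom (Fin 2) ℂ))
      (Complex.continuous_re.comp (continuous_id.matrix_trace))
  rw [ht, h.2, Complex.one_re] at h1
  exact h1

theorem law_singleton (B C ρ₀ : M2) (n : ℕ) (x : ℤ) :
    law B C ρ₀ n {x} = ENNReal.ofReal (prob B C ρ₀ n x) := by
  rw [law, Measure.sum_apply _ (measurableSet_singleton x), tsum_eq_single x]
  · simp
  · intro y hy
    simp [hy]

theorem isProbabilityMeasure_law {B C : M2} (hBC : Bᴴ * B + Cᴴ * C = 1) {ρ₀ : M2}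
    (h : IsDensity ρ₀) (n : ℕ) : IsProbabilityMeasure (law B C ρ₀ n) := by
  refine ⟨?_⟩
  rw [law, Measure.sum_apply _ MeasurableSet.univ]
  simp only [Measure.smul_apply, measure_univ, smul_eq_mul, mul_one]
  rw [← ENNReal.ofReal_tsum_of_nonneg (prob_nonneg B C h.1 n) (hasSum_prob hBC h n).summable,
    (hasSum_prob hBC h n).tsum_eq, ENNReal.ofReal_one]

theorem exB_exC : exBᴴ * exB + exCᴴ * exC = 1 := by
  have h3 : ((Real.sqrt 3 : ℝ) : ℂ)⁻¹ * ((Real.sqrt 3 : ℝ) : ℂ)⁻¹ = 1 / 3 := by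
    rw [← mul_inv, ← Complex.ofReal_mul, Real.mul_self_sqrt (by norm_num)]
    norm_num
  ext i j
  fin_cases i <;> fin_cases j <;>
    simp [exB, exC, Matrix.mul_apply, Fin.sum_univ_two, h3] <;> norm_num

end OQRW

end

/-! The characteristic function of the walk at `t` is the trace of the `n`-th iterate of `symbol B C
t` at `ρ₀`. In the example, `eigfun t` is an exact dual eigenvector with eigenvalue `eigval t`, and
it tends to the trace as `t → 0`. The iterates have entries bounded by 1 uniformly in `t` and `n`,
so at `t = s / √n` their trace is asymptotically `eigval t ^ n * eigfun t ρ₀`, with no need for a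
spectral gap. Since `eigval t - 1 ~ -(4/9) t²`, the limit is `exp(-4s²/9)`, and Lévy's continuity
theorem concludes. -/

namespace OQRW

/-! ### Characteristic function of the position. -/

/-- The Fourier symbol of the walk at frequency `t`. -/
noncomputable def symbol (B C : M2) (t : ℝ) (S : M2) : M2 :=
  Complex.exp (-(t * Complex.I)) • (B * S * Bᴴ) + Complex.exp (t * Complex.I) • (C * S * Cᴴ)

/-- Re-indexing the sum by a shift of one site pulls the phases `exp (∓ t I)` out of the two terms
of `step`. -/
theorem hasSum_exp_smul_state (B C ρ₀ : M2) (t : ℝ) (n : ℕ) :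
    HasSum (fun x : ℤ => Complex.exp (x * (t * Complex.I)) • state B C ρ₀ n x)
      ((symbol B C t)^[n] ρ₀) := by
  induction n with
  | zero =>
    convert! hasSum_pi_single (0 : ℤ) ρ₀ using 2 with x
    by_cases hx : x = 0
    · subst hx
      simp [state]
    · simp [state, hx]
  | succ n ih =>
    rw [Function.iterate_succ_apply', state_succ]
    have h1 := (Equiv.hasSum_iff (Equiv.addRight (1 : ℤ))).2 ih
    have h2 := (Equiv.hasSum_iff (Equiv.subRight (1 : ℤ))).2 ih
    refine ((((h1.mul_left B).mul_right Bᴴ).const_smul (Complex.exp (-(t * Complex.I)))).add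
      (((h2.mul_left C).mul_right Cᴴ).const_smul (Complex.exp (t * Complex.I)))).congr_fun ?_
    intro x
    simp only [step, Function.comp_apply, Equiv.coe_addRight, Equiv.subRight_apply,
      Matrix.mul_smul, Matrix.smul_mul, smul_smul, ← Complex.exp_add, smul_add, Int.cast_add,
      Int.cast_sub, Int.cast_one]
    congr 3 <;> ring_nf

/-- Nonnegativity of the determinant gives `‖ρ 0 1‖ ^ 2 ≤ ρ 0 0 * ρ 1 1`, which is at most the
squared trace. -/
theorem norm_apply_le_trace_re {ρ : M2} (h : ρ.PosSemidef) (i j : Fin 2) :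
    ‖ρ i j‖ ≤ ρ.trace.re := by
  have h0 := Complex.nonneg_iff.1 (h.diag_nonneg (i := 0))
  have h1 := Complex.nonneg_iff.1 (h.diag_nonneg (i := 1))
  have e0 : ‖ρ 0 0‖ = (ρ 0 0).re := by
    simpa using (congrArg Complex.re (Complex.norm_of_nonneg' (h.diag_nonneg (i := 0))))
  have e1 : ‖ρ 1 1‖ = (ρ 1 1).re := by
    simpa using (congrArg Complex.re (Complex.norm_of_nonneg' (h.diag_nonneg (i := 1))))
  have hd := (Complex.nonneg_iff.1 h.det_nonneg).1
  have hs : ρ 1 0 = star (ρ 0 1) := (h.1.apply 1 0).symm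
  have hn : ‖ρ 1 0‖ = ‖ρ 0 1‖ := by rw [hs, norm_star]
  have hsq : ‖ρ 0 1‖ ^ 2 ≤ (ρ 0 0).re * (ρ 1 1).re := by
    rw [Matrix.det_fin_two, hs] at hd
    simp only [Complex.sub_re, Complex.mul_re, ← h0.2, ← h1.2, Complex.star_def, Complex.conj_re,
      Complex.conj_im] at hd
    rw [Complex.sq_norm, Complex.normSq_apply]
    linarith
  have ht : ρ.trace.re = (ρ 0 0).re + (ρ 1 1).re := by
    simp [Matrix.trace_fin_two]
  have hoff : ‖ρ 0 1‖ ≤ ρ.trace.re := by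
    rw [ht]
    refine abs_le_of_sq_le_sq' ?_ (add_nonneg h0.1 h1.1) |>.2
    nlinarith [mul_nonneg h0.1 h1.1, h0.1, h1.1]
  fin_cases i <;> fin_cases j
  · simpa [e0, ht] using h1.1
  · exact hoff
  · exact hn ▸ hoff
  · simpa [e1, ht] using h0.1

/-- The phases have modulus one, so each entry is dominated by the sum of the traces of the blocks,
the total probability. -/
theorem norm_symbol_iterate_apply_le {B C : M2} (hBC : Bᴴ * B + Cᴴ * C = 1) {ρ₀ : M2}
    (h : IsDensity ρ₀) (t : ℝ) (n : ℕ) (i j : Fin 2) :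
    ‖((symbol B C t)^[n] ρ₀) i j‖ ≤ 1 := by
  have hs : HasSum (fun x : ℤ => Complex.exp (x * (t * Complex.I)) * state B C ρ₀ n x i j)
      (((symbol B C t)^[n] ρ₀) i j) :=
    Pi.hasSum.1 (Pi.hasSum.1 (hasSum_exp_smul_state B C ρ₀ t n) i) j
  refine hs.norm_le_of_bounded (hasSum_prob hBC h n) fun x => ?_
  have hx : (x : ℂ) * (t * Complex.I) = ((x * t : ℝ) : ℂ) * Complex.I := by push_cast; ring
  rw [norm_mul, hx, Complex.norm_exp_ofReal_mul_I, one_mul]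
  exact norm_apply_le_trace_re (posSemidef_state B C h.1 n x) i j

/-- The characteristic function of the law of the walk is the trace of the iterated symbol. -/
theorem integral_exp_law {B C : M2} (hBC : Bᴴ * B + Cᴴ * C = 1) {ρ₀ : M2} (h : IsDensity ρ₀)
    (t : ℝ) (n : ℕ) :
    ∫ x : ℤ, Complex.exp (x * (t * Complex.I)) ∂law B C ρ₀ n
      = ((symbol B C t)^[n] ρ₀).trace := by
  have := isProbabilityMeasure_law hBC h n
  have hint : Integrable (fun x : ℤ => Complex.exp (x * (t * Complex.I))) (law B C ρ₀ n) := by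
    refine Integrable.of_bound (C := 1) (Measurable.of_discrete.aestronglyMeasurable) ?_
    refine Eventually.of_forall fun x => ?_
    have hx : (x : ℂ) * (t * Complex.I) = ((x * t : ℝ) : ℂ) * Complex.I := by push_cast; ring
    rw [hx, Complex.norm_exp_ofReal_mul_I]
  have hs : HasSum (fun x : ℤ => (Complex.exp (x * (t * Complex.I)) • state B C ρ₀ n x).trace)
      ((symbol B C t)^[n] ρ₀).trace :=
    (hasSum_exp_smul_state B C ρ₀ t n).map (Matrix.traceAddMonoidHom (Fin 2) ℂ)
      continuous_id.matrix_trace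
  rw [integral_countable hint, ← hs.tsum_eq]
  refine tsum_congr fun x => ?_
  rw [measureReal_def, law_singleton, ENNReal.toReal_ofReal (prob_nonneg B C h.1 n x),
    Matrix.trace_smul, trace_state B C h.1, smul_eq_mul, Complex.real_smul, mul_comm]

/-! ### The leading eigenvalue and its dual eigenvector. -/

/-- The real solution `r` of `r ^ 3 + 3 * r = 4 * cos t`. -/
noncomputable def root (t : ℝ) : ℝ := 2 * Real.sinh (Real.arsinh (2 * Real.cos t) / 3)

/-- With `r = 2 sinh u`, the triple-angle formula reads `r ^ 3 + 3 r = 2 sinh (3 u)`. -/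
theorem root_cubic (t : ℝ) : root t ^ 3 + 3 * root t = 4 * Real.cos t := by
  have h := Real.sinh_three_mul (Real.arsinh (2 * Real.cos t) / 3)
  rw [mul_div_cancel₀ _ (by norm_num : (3 : ℝ) ≠ 0), Real.sinh_arsinh] at h
  unfold root
  linarith

theorem continuous_root : Continuous root := by
  have h : Continuous fun t : ℝ => Real.arsinh (2 * Real.cos t) / 3 :=
    (Real.continuous_arsinh.comp (by fun_prop)).div_const 3
  exact (Real.continuous_sinh.comp h).const_mul 2

/-- Comes from `r ^ 3 + 3 r - 4 = (r - 1) (r ^ 2 + r + 4)`, whose quadratic factor never vanishes.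
-/
theorem root_sub_one (t : ℝ) :
    root t - 1 = 4 / (root t ^ 2 + root t + 4) * (Real.cos t - 1) := by
  have h : root t ^ 2 + root t + 4 ≠ 0 := by nlinarith [sq_nonneg (root t + 1 / 2)]
  rw [div_mul_eq_mul_div, eq_div_iff h]
  linear_combination root_cubic t

theorem root_zero : root 0 = 1 := by
  have := root_sub_one 0
  simp only [Real.cos_zero, sub_self, mul_zero] at this
  linarith

/-- The leading eigenvalue of the symbol of the walk generated by `exB` and `exC`. -/
noncomputable def eigval (t : ℝ) : ℝ := (2 * Real.cos t + root t) / 3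

/-- The functional that is an eigenvector of the dual of the symbol of the walk generated by `exB`
and `exC`, normalized to be the trace at `t = 0`. -/
noncomputable def eigfun (t : ℝ) (S : M2) : ℂ :=
  ((2 * Complex.exp (t * Complex.I) ^ 2 + root t * Complex.exp (t * Complex.I)) * S 0 0
    + (1 - root t * Complex.exp (t * Complex.I)) * (S 0 1 + S 1 0)
    + (root t ^ 2 + 2) * S 1 1) / 3

/-- The operators are real, so the dual symbol preserves functionals symmetric in `S 0 1`, `S 1 0`.
On this 3-dimensional space, `3 λ = 2 cos t + r` turns the characteristic equation into the cubic of
`root`. -/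
theorem eigfun_symbol (t : ℝ) (S : M2) :
    eigfun t (symbol exB exC t S) = eigval t * eigfun t S := by
  have h3 : ((Real.sqrt 3 : ℝ) : ℂ)⁻¹ ^ 2 = 1 / 3 := by
    rw [inv_pow, ← Complex.ofReal_pow, Real.sq_sqrt (by norm_num)]
    norm_num
  have hzw : Complex.exp (-(t * Complex.I)) * Complex.exp (t * Complex.I) = 1 := by
    rw [← Complex.exp_add]; simp
  have hc : 2 * (Real.cos t : ℂ) = Complex.exp (-(t * Complex.I)) + Complex.exp (t * Complex.I) := by
    rw [Complex.ofReal_cos, Complex.two_cos]; ring_nf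
  have hr : (root t : ℂ) ^ 3 + 3 * root t = 2 * (2 * (Real.cos t : ℂ)) := by
    have := root_cubic t
    apply_fun ((↑) : ℝ → ℂ) at this
    push_cast at this ⊢
    rw [this]; ring
  have hB : ∀ A : M2, (((1 / Real.sqrt 3 : ℝ) : ℂ) • A) * S * (((1 / Real.sqrt 3 : ℝ) : ℂ) • A)ᴴ
      = (1 / 3 : ℂ) • (A * S * Aᴴ) := by
    intro A
    rw [Matrix.conjTranspose_smul, Matrix.smul_mul, Matrix.smul_mul, Matrix.mul_smul, smul_smul,
      ← h3]
    simp [sq]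
  simp only [eigfun, eigval, symbol, exB, exC, hB]
  rw [hc] at hr
  rw [Complex.ofReal_div, Complex.ofReal_add, Complex.ofReal_mul, Complex.ofReal_ofNat, hc,
    Complex.ofReal_ofNat]
  generalize Complex.exp (t * Complex.I) = w at *
  generalize Complex.exp (-(t * Complex.I)) = z at *
  generalize (root t : ℂ) = r at *
  simp only [Matrix.add_apply, Matrix.smul_apply, Matrix.mul_apply, Fin.sum_univ_two,
    Matrix.conjTranspose_apply, smul_eq_mul]
  simp
  linear_combination ((2 * w + r) * (S 0 1 + S 1 0) + (2 * w - r) * S 1 1) / 9 * hzw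
    - S 1 1 / 9 * hr

theorem eigfun_symbol_iterate (t : ℝ) (S : M2) (n : ℕ) :
    eigfun t ((symbol exB exC t)^[n] S) = eigval t ^ n * eigfun t S := by
  induction n with
  | zero => simp
  | succ n ih => rw [Function.iterate_succ_apply', eigfun_symbol, ih, pow_succ']; ring

/-! ### Asymptotics at frequency `s / √n`. -/

theorem tendsto_div_sqrt_nat (s : ℝ) :
    Tendsto (fun n : ℕ => s / Real.sqrt n) atTop (𝓝 0) :=
  tendsto_const_nhds.div_atTop (Real.tendsto_sqrt_atTop.comp tendsto_natCast_atTop_atTop)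

theorem tendsto_nat_mul_cos_sub_one (s : ℝ) :
    Tendsto (fun n : ℕ => (n : ℝ) * (Real.cos (s / Real.sqrt n) - 1)) atTop (𝓝 (-(s ^ 2 / 2))) := by
  have h0 : Tendsto (fun n : ℕ => s / Real.sqrt n / 2) atTop (𝓝 0) := by
    simpa using (tendsto_div_sqrt_nat s).div_const 2
  have h1 := (((Real.continuous_sinc.tendsto 0).comp h0).pow 2).const_mul (-(s ^ 2 / 2))
  rw [Real.sinc_zero, one_pow, mul_one] at h1
  refine h1.congr' ?_
  filter_upwards [eventually_gt_atTop 0] with n hn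
  have hn' : (0 : ℝ) < n := by exact_mod_cast hn
  have hsin : ∀ y : ℝ, Real.sin y = y * Real.sinc y := by
    intro y
    by_cases hy : y = 0
    · simp [hy]
    · rw [Real.sinc_of_ne_zero hy, mul_div_cancel₀ _ hy]
  have hcos : Real.cos (s / Real.sqrt n) - 1 = -2 * Real.sin (s / Real.sqrt n / 2) ^ 2 := by
    rw [Real.sin_sq_eq_half_sub]
    ring_nf
  rw [hcos, hsin, Function.comp_apply, mul_pow, div_pow, div_pow, Real.sq_sqrt hn'.le]
  field_simp

theorem tendsto_eigval_pow (s : ℝ) :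
    Tendsto (fun n : ℕ => eigval (s / Real.sqrt n) ^ n) atTop (𝓝 (Real.exp (-(4 / 9 * s ^ 2)))) := by
  have hroot : Tendsto (fun n : ℕ => root (s / Real.sqrt n)) atTop (𝓝 1) := by
    have := (continuous_root.tendsto 0).comp (tendsto_div_sqrt_nat s)
    rwa [root_zero] at this
  -- By `root_sub_one` this is the ratio of `eigval t - 1` to `cos t - 1`; its limit `8 / 9` is the
  -- variance.
  have hcoef : Tendsto (fun n : ℕ => (2 + 4 / (root (s / Real.sqrt n) ^ 2
      + root (s / Real.sqrt n) + 4)) / 3) atTop (𝓝 ((2 + 4 / (1 ^ 2 + 1 + 4)) / 3)) :=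
    ((tendsto_const_nhds.div (((hroot.pow 2).add hroot).add_const 4) (by norm_num)).const_add
      2).div_const 3
  have hlim : Tendsto (fun n : ℕ => (n : ℝ) * (eigval (s / Real.sqrt n) - 1)) atTop
      (𝓝 (-(4 / 9 * s ^ 2))) := by
    have := hcoef.mul (tendsto_nat_mul_cos_sub_one s)
    convert! this using 2 with n
    · have := root_sub_one (s / Real.sqrt n)
      rw [eigval]
      linear_combination (n : ℝ) / 3 * this
    · norm_num
      ring
  simpa using Real.tendsto_one_add_pow_exp_of_tendsto hlim

/-- The functionals `eigfun t` converge to the trace, uniformly on bounded sets. -/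
theorem tendsto_eigfun_sub_trace {t : ℕ → ℝ} (ht : Tendsto t atTop (𝓝 0)) {S : ℕ → M2}
    (hS : ∀ n i j, ‖S n i j‖ ≤ 1) :
    Tendsto (fun n => eigfun (t n) (S n) - (S n).trace) atTop (𝓝 0) := by
  -- Applied to the coefficients of `eigfun` minus those of the trace, which vanish at frequency 0.
  have hb : ∀ {c : ℝ → ℂ} (_ : Continuous c) (_ : c 0 = 0) (i j : Fin 2),
      Tendsto (fun n => c (t n) * S n i j) atTop (𝓝 0) := by
    intro c hc hc0 i j
    refine squeeze_zero_norm (a := fun n => ‖c (t n)‖) (fun n => ?_) ?_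
    · rw [norm_mul]
      exact mul_le_of_le_one_right (norm_nonneg _) (hS n i j)
    · simpa [hc0] using ((hc.tendsto 0).comp ht).norm
  have hr : Continuous fun u : ℝ => (root u : ℂ) := Complex.continuous_ofReal.comp continuous_root
  have h0 := hb (c := fun u => (2 * Complex.exp (u * Complex.I) ^ 2
    + root u * Complex.exp (u * Complex.I)) / 3 - 1) (by fun_prop) (by norm_num [root_zero]) 0 0
  have h1 := hb (c := fun u => (1 - root u * Complex.exp (u * Complex.I)) / 3) (by fun_prop)
    (by simp [root_zero])
  have h2 := hb (c := fun u => ((root u : ℂ) ^ 2 + 2) / 3 - 1) (by fun_prop)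
    (by norm_num [root_zero]) 1 1
  have := ((h0.add (h1 0 1)).add (h1 1 0)).add h2
  rw [add_zero, add_zero, add_zero] at this
  refine this.congr fun n => ?_
  rw [eigfun, Matrix.trace_fin_two]
  ring

theorem tendsto_trace_symbol_iterate {ρ₀ : M2} (h : IsDensity ρ₀) (s : ℝ) :
    Tendsto (fun n : ℕ => ((symbol exB exC (s / Real.sqrt n))^[n] ρ₀).trace) atTop
      (𝓝 (Complex.exp (-(4 / 9 * s ^ 2)))) := by
  -- The zeroth iterate is `ρ₀` itself, so the bound on iterates also covers the constant sequence.
  have h1 := tendsto_eigfun_sub_trace (tendsto_div_sqrt_nat s) (S := fun _ => ρ₀)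
    fun n i j => norm_symbol_iterate_apply_le exB_exC h 0 0 i j
  have h2 := tendsto_eigfun_sub_trace (tendsto_div_sqrt_nat s)
    (S := fun n => (symbol exB exC (s / Real.sqrt n))^[n] ρ₀)
    fun n => norm_symbol_iterate_apply_le exB_exC h _ n
  have h3 := (Complex.continuous_ofReal.tendsto _).comp (tendsto_eigval_pow s)
  have h4 := (h3.mul (h1.add_const 1)).sub h2
  rw [zero_add, mul_one, sub_zero] at h4
  push_cast at h4
  refine h4.congr fun n => ?_
  rw [eigfun_symbol_iterate, h.2]
  simp

end OQRW

/-- Let `X n` be the position at time `n` of the walker of the open quantum random walk generated by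
`exB` and `exC`, started in `ρ₀ ⊗ |0⟩⟨0|`. Then `X n / √n` converges in law to `N(0, 8/9)`
(`8 / 9` is the variance; the limit is the identity variable on `ℝ` under that Gaussian law). -/
theorem mainTheorem2 (ρ₀ : OQRW.M2) (hρ₀ : OQRW.IsDensity ρ₀)
    {Ω : ℕ → Type*} [∀ n, MeasurableSpace (Ω n)]
    (P : ∀ n, Measure (Ω n)) [∀ n, IsProbabilityMeasure (P n)]
    (X : ∀ n, Ω n → ℤ)
    (hX : ∀ n, HasLaw (X n) (OQRW.law OQRW.exB OQRW.exC ρ₀ n) (P n)) :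
    TendstoInDistribution (fun n ω => (X n ω : ℝ) / Real.sqrt n) atTop
      (id : ℝ → ℝ) P (gaussianReal 0 (8 / 9)) := by
  have hm : ∀ n, AEMeasurable (fun ω => (X n ω : ℝ) / Real.sqrt n) (P n) := fun n =>
    (Measurable.of_discrete (f := fun x : ℤ => (x : ℝ) / Real.sqrt n)).comp_aemeasurable
      (hX n).aemeasurable
  refine ⟨hm, aemeasurable_id, ProbabilityMeasure.tendsto_iff_tendsto_charFun.2 fun s => ?_⟩
  have hg : charFun ((gaussianReal 0 (8 / 9)).map id) s = Complex.exp (-(4 / 9 * s ^ 2)) := by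
    rw [Measure.map_id, charFun_gaussianReal]
    congr 1
    push_cast
    ring
  simp only [ProbabilityMeasure.coe_mk]
  rw [hg]
  refine (OQRW.tendsto_trace_symbol_iterate hρ₀ s).congr fun n => ?_
  rw [← OQRW.integral_exp_law OQRW.exB_exC hρ₀, charFun_apply_real,
    integral_map (hm n) (by fun_prop), ← (hX n).map_eq,
    integral_map (hX n).aemeasurable Measurable.of_discrete.aestronglyMeasurable]
  refine integral_congr_ae (Eventually.of_forall fun ω => ?_)
  simp only
  congr 1
  push_cast
  ring
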